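/- Let $\mathbb{D}=\{z\in\mathbb{C}:|z|<1\}$, and let $r_1:[0,1]\to\mathbb{R}$ be given by $r_1(x)=\sqrt{(1-x)/2}$ for $0\le x<\tfrac12$ and $r_1(x)=\dfrac{1}{1+2x}$ for $\tfrac12\le x\le 1$. For analytic functions $f,g$ in $\mathbb{D}$ write $f\prec g$ ($f$ is subordinate to $g$) if there is an analytic function $\omega$ in $\mathbb{D}$ with $|\omega|\le 1$ and $\omega(0)=0$ such that $f(z)=g(\omega(z))$ for all $z\in\mathbb{D}$. Let $f(z)=\sum_{k=0}^\infty a_kz^k$ and $g(z)=\sum_{k=0}^\infty b_kz^k$ be analytic in $\mathbb{D}$ with $f\prec g$. Then (a) if $b_1\ne 0$, then $\sum_{k=0}^\infty|a_k|r^k\le\sum_{k=0}^\infty|b_k|r^k$ (both series converging) for all $0\le r\le r_1(|a_1/b_1|)$; (b) if $b_1=0$, then $\sum_{k=0}^\infty|a_k|r^k\le\sum_{k=0}^\infty|b_k|r^k$ (both series converging) for all $0\le r\le 1/3$. Moreover, the radius in (a) cannot be improved if $|a_1/b_1|\in[1/2,1)\cup\{0\}$: for every $x\in[1/2,1)\cup\{0\}$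 and every $R>r_1(x)$ there are $f\prec g$ as above with $b_1\ne0$ and $|a_1/b_1|=x$, and some $r$ with $r_1(x)<r<\min\{R,1\}$, such that $\sum_{k=0}^\infty|a_k|r^k>\sum_{k=0}^\infty|b_k|r^k$. Likewise, the constant $1/3$ in (b) cannot be improved: for every $R>1/3$ there are $f\prec g$ as above with $b_1=0$, and some $r$ with $1/3<r<\min\{R,1\}$, such that $\sum_{k=0}^\infty|a_k|r^k>\sum_{k=0}^\infty|b_k|r^k$. -/

import Mathlib

namespace BohrSubordination

noncomputable section

/-- The open unit disk in the complex plane. -/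
def disk : Set ℂ := Metric.ball (0 : ℂ) 1

/-- The class of analytic functions in the unit disk that are bounded by one in modulus. -/
def ClassB (f : ℂ → ℂ) : Prop :=
  DifferentiableOn ℂ f disk ∧ ∀ z ∈ disk, ‖f z‖ ≤ 1

/-- `f` is analytic in the unit disk with Taylor expansion `f z = ∑ a k * z ^ k` there. -/
def HasTaylor (f : ℂ → ℂ) (a : ℕ → ℂ) : Prop :=
  DifferentiableOn ℂ f disk ∧ ∀ z ∈ disk, HasSum (fun k : ℕ => a k * z ^ k) (f z)

/-- Subordination `f ≺ g` in the unit disk: `f z = g (ω z)` for an analytic `ω` bounded by one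
that fixes the origin (by the maximum principle such an `ω` maps the disk into itself). -/
def Subordinate (f g : ℂ → ℂ) : Prop :=
  ∃ ω : ℂ → ℂ, ClassB ω ∧ ω 0 = 0 ∧ ∀ z ∈ disk, f z = g (ω z)

/-- The sum of the majorant series `∑ |a k| r ^ k`. -/
def majorant (a : ℕ → ℂ) (r : ℝ) : ℝ := ∑' k : ℕ, ‖a k‖ * r ^ k

/-- The radius function, used on `[0, 1]` only. -/
def radius (x : ℝ) : ℝ :=
  if x < 1 / 2 then Real.sqrt ((1 - x) / 2) else 1 / (1 + 2 * x)

end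

end BohrSubordination

open Metric Set Filter Topology MeasureTheory AddCircle
open scoped ComplexConjugate

namespace BohrSubordination

/-! ### Parseval's identity for absolutely convergent power series -/

/-! Write M(h, r) for the majorant sum of h at r. By the Schwarz lemma `ω z = z * φ z` with `φ`
bounded by one, and `φ 0 = deriv ω 0`, which is `a 1 / b 1` when `b 1 ≠ 0`. If M(φ, r) ≤ 1 then M(ω,
r) ≤ r, and since M is submultiplicative, expanding f = ∑ b_k ω^k gives M(f, r) ≤ ∑ |b_k| r^k
(`majorant_comp_le`). When `b 1 = 0` only |φ(0)| ≤ 1 is known, and the radius function is at least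
1/3 there.

It remains to bound M(φ, r) in terms of A = |φ(0)| (`HasTaylor.majorant_le_one`). The Schwarz–Pick
inequality, integrated over a circle with Parseval, bounds the weighted sum ∑_{n≥1} |p_n|² ρ^n
(`HasTaylor.sum_norm_sq_le`). Cauchy–Schwarz then bounds ∑_{n≥1} |p_n| r^n, with ρ free to be
chosen.

For sharpness, g = z^k and ω = z^m (x - z)/(1 - xz), with (m, k) = (1, 1) for x ≥ 1/2, (2, 1) for x
= 0, and (1, 2) with x near 1 for the constant 1/3. -/

theorem _root_.Orthonormal.hasSum_norm_sq {𝕜 E ι : Type*} [RCLike 𝕜] [NormedAddCommGroup E]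
    [InnerProductSpace 𝕜 E] {v : ι → E} (hv : Orthonormal 𝕜 v) {c : ι → 𝕜} {x : E}
    (h : HasSum (fun i => c i • v i) x) : HasSum (fun i => ‖c i‖ ^ 2) (‖x‖ ^ 2) := by
  classical
  have coord (i : ι) : inner 𝕜 (v i) x = c i := by
    have h1 := (innerSL 𝕜 (v i)).hasSum h
    have h2 : (fun j => innerSL 𝕜 (v i) (c j • v j)) = fun j => if j = i then c i else 0 := by
      ext j
      rw [innerSL_apply_apply, inner_smul_right, orthonormal_iff_ite.1 hv i j]
      by_cases hij : i = j
      · simp [hij]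
      · simp [hij, Ne.symm hij]
    rw [h2] at h1
    exact h1.unique (hasSum_ite_eq i (c i))
  have h1 := (innerSL 𝕜 x).hasSum h
  have h2 : (fun j => innerSL 𝕜 x (c j • v j)) = fun j => ((‖c j‖ ^ 2 : ℝ) : 𝕜) := by
    ext j
    rw [innerSL_apply_apply, inner_smul_right, ← inner_conj_symm, coord, RCLike.mul_conj]
    norm_cast
  rw [h2, innerSL_apply_apply, inner_self_eq_norm_sq_to_K] at h1
  exact_mod_cast h1

attribute [local instance] Polynomial.instTwoPiPos

theorem exists_continuousMap_hasSum {c : ℕ → ℂ} (hc : Summable fun n => ‖c n‖) :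
    ∃ G : C(AddCircle (2 * Real.pi), ℂ),
      (∀ t, HasSum (fun n => c n * (toCircle t : ℂ) ^ n) (G t)) ∧
      HasSum (fun n => ‖c n‖ ^ 2) (∫ t, ‖G t‖ ^ 2 ∂haarAddCircle) := by
  have hs : Summable fun n : ℕ => c n • (fourier (n : ℤ) : C(AddCircle (2 * Real.pi), ℂ)) := by
    refine Summable.of_norm ?_
    simpa [norm_smul, fourier_norm] using hc
  obtain ⟨G, hG⟩ := hs
  refine ⟨G, fun t => ?_, ?_⟩
  · have := (ContinuousMap.evalCLM ℂ t).hasSum hG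
    simpa [AddCircle.toCircle_nsmul] using this
  · have h1 := (ContinuousMap.toLp (E := ℂ) 2 (haarAddCircle (T := 2 * Real.pi)) ℂ).hasSum hG
    have ho : Orthonormal ℂ fun n : ℕ =>
        (fourierLp 2 (n : ℤ) : Lp ℂ 2 (haarAddCircle (T := 2 * Real.pi))) :=
      orthonormal_fourier.comp _ Nat.cast_injective
    have h2 := ho.hasSum_norm_sq (c := c) (by simpa only [map_smul] using h1)
    convert h2 using 1
    have h3 := ContinuousMap.inner_toLp (𝕜 := ℂ) (haarAddCircle (T := 2 * Real.pi)) G G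
    rw [inner_self_eq_norm_sq_to_K] at h3
    have h4 : ∀ t, G t * conj (G t) = ((‖G t‖ ^ 2 : ℝ) : ℂ) := fun t => by
      rw [Complex.mul_conj, Complex.normSq_eq_norm_sq]
    simp_rw [h4] at h3
    rw [integral_complex_ofReal] at h3
    refine Complex.ofReal_injective (h3.symm.trans ?_)
    simp

/-- Squaring the pointwise bound and integrating over the unit circle turns both sides into
coefficient sums by Parseval. -/
theorem tsum_norm_sq_le_of_norm_le {u v : ℕ → ℂ} (hu : Summable fun n => ‖u n‖)
    (hv : Summable fun n => ‖v n‖) {s : ℝ}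
    (h : ∀ ζ : ℂ, ‖ζ‖ = 1 → ‖∑' n, u n * ζ ^ n‖ ≤ s * ‖∑' n, v n * ζ ^ n‖) :
    ∑' n, ‖u n‖ ^ 2 ≤ s ^ 2 * ∑' n, ‖v n‖ ^ 2 := by
  obtain ⟨U, hU, hU2⟩ := exists_continuousMap_hasSum hu
  obtain ⟨V, hV, hV2⟩ := exists_continuousMap_hasSum hv
  rw [hU2.tsum_eq, hV2.tsum_eq, ← integral_const_mul]
  refine integral_mono ?_ ?_ fun t => ?_
  · exact (Continuous.integrable_of_hasCompactSupport (by fun_prop)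
      (HasCompactSupport.of_compactSpace _))
  · exact (Continuous.integrable_of_hasCompactSupport (by fun_prop)
      (HasCompactSupport.of_compactSpace _))
  · have := h (toCircle t) (Circle.norm_coe _)
    rw [(hU t).tsum_eq, (hV t).tsum_eq] at this
    simpa [mul_pow] using pow_le_pow_left₀ (norm_nonneg _) this 2

/-! ### Taylor coefficients -/

variable {f g φ ω ψ : ℂ → ℂ} {a b p : ℕ → ℂ}

theorem mem_disk {z : ℂ} : z ∈ disk ↔ ‖z‖ < 1 := by simp [disk]

theorem ofReal_mem_disk {r : ℝ} (h0 : 0 ≤ r) (h1 : r < 1) : (r : ℂ) ∈ disk := by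
  simpa [mem_disk, abs_of_nonneg h0] using h1

theorem exists_hasTaylor (hf : DifferentiableOn ℂ f disk) : ∃ a, HasTaylor f a :=
  ⟨fun n => (n.factorial : ℂ)⁻¹ * iteratedDeriv n f 0, hf, fun z hz => by
    have := Complex.hasSum_taylorSeries_on_ball hf hz
    convert! this using 2 with n
    simp only [smul_eq_mul, sub_zero]
    ring⟩

theorem HasTaylor.apply_zero (hf : HasTaylor f a) : f 0 = a 0 := by
  refine (hf.2 0 (by simp [disk])).unique ?_
  convert hasSum_single (f := fun k : ℕ => a k * 0 ^ k) 0 (by intro n hn; simp [hn]) using 1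
  simp

theorem HasTaylor.summable (hf : HasTaylor f a) {r : ℝ} (h0 : 0 ≤ r) (h1 : r < 1) :
    Summable fun k => ‖a k‖ * r ^ k := by
  have := (hf.2 r (ofReal_mem_disk h0 h1)).summable.norm
  simpa [abs_of_nonneg h0] using this

theorem hasFPowerSeriesOnBall_of_hasSum {r : ℝ} (h0 : 0 < r)
    (hs : Summable fun k => ‖a k‖ * r ^ k)
    (h : ∀ z : ℂ, ‖z‖ < r → HasSum (fun k => a k * z ^ k) (f z)) :
    HasFPowerSeriesOnBall f (FormalMultilinearSeries.ofScalars ℂ a) 0 (ENNReal.ofReal r) where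
  r_le := by
    refine FormalMultilinearSeries.le_radius_of_summable (r := r.toNNReal) _ ?_
    refine hs.congr fun n => ?_
    simp [h0.le]
  r_pos := by simpa using h0
  hasSum {z} hz := by
    have hz : ‖z‖ < r := by
      rw [Metric.mem_eball, edist_zero_right, ← ofReal_norm] at hz
      exact (ENNReal.ofReal_lt_ofReal_iff h0).1 hz
    simpa [FormalMultilinearSeries.ofScalars, mul_comm] using h z hz

theorem coeff_unique {c d : ℕ → ℂ} {r : ℝ} (h0 : 0 < r)
    (hs : Summable fun k => ‖c k‖ * r ^ k) (ht : Summable fun k => ‖d k‖ * r ^ k)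
    (hc : ∀ z : ℂ, ‖z‖ < r → HasSum (fun k => c k * z ^ k) (f z))
    (hd : ∀ z : ℂ, ‖z‖ < r → HasSum (fun k => d k * z ^ k) (f z)) : c = d := by
  have := (hasFPowerSeriesOnBall_of_hasSum h0 hs hc).hasFPowerSeriesAt.eq_formalMultilinearSeries
    (hasFPowerSeriesOnBall_of_hasSum h0 ht hd).hasFPowerSeriesAt
  ext n
  have h2 := congrArg (fun P => FormalMultilinearSeries.coeff P n) this
  simpa using h2

theorem HasTaylor.hasDerivAt (hf : HasTaylor f a) : HasDerivAt f (a 1) 0 := by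
  have := (hasFPowerSeriesOnBall_of_hasSum (by norm_num : (0 : ℝ) < 1 / 2)
    (hf.summable (by norm_num) (by norm_num))
    fun z hz => hf.2 z (mem_disk.2 (by linarith))).hasFPowerSeriesAt.hasDerivAt
  simpa using this

/-! ### The Bohr radius of a bounded analytic function with prescribed value at the origin -/

/-- The difference of the squares factors as (1 - |α|²)(1 - |w|²). -/
theorem norm_sub_le_norm_one_sub_conj_mul {α w : ℂ} (hα : ‖α‖ ≤ 1) (hw : ‖w‖ ≤ 1) :
    ‖w - α‖ ≤ ‖1 - conj α * w‖ := by
  refine le_of_sq_le_sq ?_ (norm_nonneg _)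
  have h1 : 0 ≤ (1 - ‖α‖ ^ 2) * (1 - ‖w‖ ^ 2) :=
    mul_nonneg (by nlinarith [norm_nonneg α]) (by nlinarith [norm_nonneg w])
  have h2 : ‖1 - conj α * w‖ ^ 2 - ‖w - α‖ ^ 2 = (1 - ‖α‖ ^ 2) * (1 - ‖w‖ ^ 2) := by
    simp only [← Complex.normSq_eq_norm_sq, Complex.normSq_apply]
    simp
    ring
  linarith

theorem one_sub_conj_mul_ne_zero {α w : ℂ} (hα : ‖α‖ < 1) (hw : ‖w‖ ≤ 1) :
    1 - conj α * w ≠ 0 := by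
  intro h
  have h1 : ‖conj α * w‖ = 1 := by rw [← sub_eq_zero.1 h, norm_one]
  rw [norm_mul, RCLike.norm_conj] at h1
  nlinarith [norm_nonneg α, norm_nonneg w]

/-- Schwarz–Pick at the origin: the Schwarz lemma applied to (φ - φ(0)) / (1 - conj φ(0) φ).
Clearing the denominator lets the bound cover |φ(0)| = 1 too, where φ is constant by the maximum
principle. -/
theorem ClassB.norm_sub_le (hφ : ClassB φ) {z : ℂ} (hz : z ∈ disk) :
    ‖φ z - φ 0‖ ≤ ‖z‖ * ‖1 - conj (φ 0) * φ z‖ := by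
  have h0 : (0 : ℂ) ∈ disk := by simp [disk]
  rcases (hφ.2 0 h0).lt_or_eq with hlt | heq
  · have hne (w : ℂ) (hw : w ∈ disk) := one_sub_conj_mul_ne_zero hlt (hφ.2 w hw)
    have hd : DifferentiableOn ℂ (fun w => (φ w - φ 0) / (1 - conj (φ 0) * φ w)) (ball 0 1) :=
      (hφ.1.sub_const _).div ((hφ.1.const_mul _).const_sub _) hne
    have hm : MapsTo (fun w => (φ w - φ 0) / (1 - conj (φ 0) * φ w)) (ball 0 1)
        (closedBall 0 1) := fun w hw => by
      rw [mem_closedBall_zero_iff, norm_div]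
      exact div_le_one_of_le₀ (norm_sub_le_norm_one_sub_conj_mul hlt.le (hφ.2 w hw))
        (norm_nonneg _)
    have := Complex.norm_le_norm_of_mapsTo_ball hd hm (by simp) (mem_disk.1 hz)
    rwa [norm_div, div_le_iff₀ (norm_pos_iff.2 (hne z hz))] at this
  · have := Complex.eqOn_of_isPreconnected_of_isMaxOn_norm (convex_ball (0 : ℂ) 1).isPreconnected
      isOpen_ball hφ.1 h0 (fun w hw => by simpa [heq] using hφ.2 w hw) hz
    rw [this, Function.const_apply, sub_self, norm_zero]
    positivity

/-- The functions φ - φ(0) and 1 - conj φ(0) φ share their higher coefficients up to the factor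
-conj φ(0). With T = ∑_{n≥1} |p_n|² ρ^n, Parseval and Schwarz–Pick on |z|² = ρ give T ≤ ρ ((1 - A²)²
+ A² T), which is solved for T. -/
theorem HasTaylor.sum_norm_sq_le (hφ : ClassB φ) (hp : HasTaylor φ p) {ρ : ℝ} (h0 : 0 ≤ ρ)
    (h1 : ρ ≤ 1) (N : ℕ) :
    (1 - ‖p 0‖ ^ 2 * ρ) * ∑ n ∈ Finset.range N, ‖p (n + 1)‖ ^ 2 * ρ ^ (n + 1) ≤
      ρ * (1 - ‖p 0‖ ^ 2) ^ 2 := by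
  -- Partial sums are continuous in ρ, so the endpoint ρ = 1, where the full series is not
  -- available, follows by closure.
  suffices H : Ico 0 1 ⊆ {ρ : ℝ | (1 - ‖p 0‖ ^ 2 * ρ) *
      ∑ n ∈ Finset.range N, ‖p (n + 1)‖ ^ 2 * ρ ^ (n + 1) ≤ ρ * (1 - ‖p 0‖ ^ 2) ^ 2} by
    have := closure_minimal H (isClosed_le (by fun_prop) (by fun_prop))
    rw [closure_Ico zero_ne_one] at this
    exact this ⟨h0, h1⟩
  rintro ρ ⟨h0, h1⟩
  obtain ⟨s, hs0, rfl⟩ : ∃ s : ℝ, 0 ≤ s ∧ s ^ 2 = ρ := ⟨√ρ, Real.sqrt_nonneg _, Real.sq_sqrt h0⟩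
  have hs1 : s < 1 := by nlinarith
  have ha : ‖p 0‖ ≤ 1 := hp.apply_zero ▸ hφ.2 0 (by simp [disk])
  set A := ‖p 0‖ with hA
  let t : ℕ → ℂ := fun n => p (n + 1) * s ^ (n + 1)
  let u : ℕ → ℂ := fun n => Nat.casesOn n 0 t
  let v : ℕ → ℂ := fun n => Nat.casesOn n (1 - (A : ℂ) ^ 2) fun k => -conj (p 0) * t k
  have ht : Summable fun n => ‖t n‖ := by
    have := (summable_nat_add_iff 1).2 (hp.summable hs0 hs1)
    simpa [t, abs_of_nonneg hs0] using this
  have hu : Summable fun n => ‖u n‖ := (summable_nat_add_iff 1).1 (by simpa [u] using ht)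
  have hv : Summable fun n => ‖v n‖ :=
    (summable_nat_add_iff 1).1 (by simpa [v] using ht.mul_left _)
  have key : ∑' n, ‖u n‖ ^ 2 ≤ s ^ 2 * ∑' n, ‖v n‖ ^ 2 := by
    refine tsum_norm_sq_le_of_norm_le hu hv fun ζ hζ => ?_
    have hz : (s : ℂ) * ζ ∈ disk := by
      simpa [mem_disk, hζ, abs_of_nonneg hs0] using hs1
    have hT : HasSum (fun n => t n * ζ ^ (n + 1)) (φ (s * ζ) - p 0) := by
      have := (hasSum_nat_add_iff' 1).2 (hp.2 _ hz)
      simpa [t, mul_pow, mul_assoc] using this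
    have hU : HasSum (fun n => u n * ζ ^ n) (φ (s * ζ) - p 0) := by
      refine (hasSum_nat_add_iff' 1).1 ?_
      simpa [u] using hT
    have hV : HasSum (fun n => v n * ζ ^ n) (1 - conj (p 0) * φ (s * ζ)) := by
      refine (hasSum_nat_add_iff' 1).1 ?_
      convert! hT.mul_left (-conj (p 0)) using 1
      · funext n
        simp only [v]
        ring
      · have : (A : ℂ) ^ 2 = conj (p 0) * p 0 := by
          rw [mul_comm, Complex.mul_conj, Complex.normSq_eq_norm_sq]
          push_cast; rfl
        have hv0 : v 0 = 1 - conj (p 0) * p 0 := this ▸ rfl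
        rw [Finset.sum_range_one, pow_zero, mul_one, hv0]
        ring
    rw [hU.tsum_eq, hV.tsum_eq]
    have := hφ.norm_sub_le hz
    rwa [hp.apply_zero, norm_mul, hζ, mul_one, Complex.norm_real, Real.norm_of_nonneg hs0] at this
  have sq_summable {w : ℕ → ℂ} (hw : Summable fun n => ‖w n‖) : Summable fun n => ‖w n‖ ^ 2 := by
    have := summable_mul_of_summable_norm (f := fun n => ‖w n‖) (g := fun n => ‖w n‖)
      (by simpa using hw) (by simpa using hw)
    simpa [Function.comp_def, sq] using this.comp_injective (i := fun n : ℕ => (n, n))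
      fun x y h => (Prod.ext_iff.1 h).1
  rw [(sq_summable hu).tsum_eq_zero_add, (sq_summable hv).tsum_eq_zero_add] at key
  have hv0 : ‖v 0‖ = 1 - A ^ 2 := by
    have : v 0 = ((1 - A ^ 2 : ℝ) : ℂ) := by simp [v]
    rw [this, Complex.norm_real, Real.norm_of_nonneg]
    nlinarith [norm_nonneg (p 0)]
  have hv1 (n : ℕ) : ‖v (n + 1)‖ ^ 2 = A ^ 2 * ‖t n‖ ^ 2 := by simp [v, mul_pow, A]
  have hu0 : ‖u 0‖ ^ 2 = 0 := by simp [u]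
  have hu1 (n : ℕ) : u (n + 1) = t n := rfl
  simp only [hv0, hv1, tsum_mul_left, hu0, hu1, zero_add] at key
  have hle : ∑ n ∈ Finset.range N, ‖p (n + 1)‖ ^ 2 * (s ^ 2) ^ (n + 1) ≤ ∑' n, ‖t n‖ ^ 2 := by
    refine le_trans (le_of_eq (Finset.sum_congr rfl fun n _ => ?_))
      ((sq_summable ht).sum_le_tsum (Finset.range N) fun n _ => by positivity)
    rw [norm_mul, norm_pow, Complex.norm_real, Real.norm_of_nonneg hs0, mul_pow, ← pow_mul,
      ← pow_mul, mul_comm 2]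
  have hpos : 0 ≤ 1 - A ^ 2 * s ^ 2 := by
    have : A * s ≤ 1 := mul_le_one₀ ha hs0 hs1.le
    nlinarith [mul_nonneg (norm_nonneg (p 0)) hs0]
  have := mul_le_mul_of_nonneg_left hle hpos
  rw [mem_ofPred_eq]
  nlinarith

/-- Cauchy–Schwarz after splitting r^n = σ^n (r/σ)^n with σ² = ρ; the second factor sums to r²/(ρ -
r²). -/
theorem HasTaylor.sum_norm_le_of_weight (hφ : ClassB φ) (hp : HasTaylor φ p) {r ρ B : ℝ}
    (hr : r ^ 2 < ρ) (hρ : ρ ≤ 1) (hB : 0 ≤ B) (hpos : ‖p 0‖ ^ 2 * ρ < 1)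
    (h : ρ * (1 - ‖p 0‖ ^ 2) ^ 2 * r ^ 2 ≤ B ^ 2 * ((1 - ‖p 0‖ ^ 2 * ρ) * (ρ - r ^ 2))) (N : ℕ) :
    ∑ n ∈ Finset.range N, ‖p (n + 1)‖ * r ^ (n + 1) ≤ B := by
  have hρ0 : 0 < ρ := (sq_nonneg r).trans_lt hr
  set σ := √ρ
  have hσ : σ ^ 2 = ρ := Real.sq_sqrt hρ0.le
  have hσ0 : 0 < σ := Real.sqrt_pos.2 hρ0
  have hcs := Finset.sum_mul_sq_le_sq_mul_sq (Finset.range N)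
    (fun n => ‖p (n + 1)‖ * σ ^ (n + 1)) (fun n => (r / σ) ^ (n + 1))
  have e1 : ∑ n ∈ Finset.range N, ‖p (n + 1)‖ * σ ^ (n + 1) * (r / σ) ^ (n + 1) =
      ∑ n ∈ Finset.range N, ‖p (n + 1)‖ * r ^ (n + 1) := Finset.sum_congr rfl fun n _ => by
    rw [mul_assoc, ← mul_pow, mul_div_cancel₀ _ hσ0.ne']
  have e2 : ∑ n ∈ Finset.range N, (‖p (n + 1)‖ * σ ^ (n + 1)) ^ 2 =
      ∑ n ∈ Finset.range N, ‖p (n + 1)‖ ^ 2 * ρ ^ (n + 1) := Finset.sum_congr rfl fun n _ => by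
    rw [mul_pow, ← hσ]; ring
  have e3 : ∑ n ∈ Finset.range N, ((r / σ) ^ (n + 1)) ^ 2 ≤ r ^ 2 / (ρ - r ^ 2) := by
    have hq : r ^ 2 / ρ < 1 := (div_lt_one hρ0).2 hr
    have hq0 : 0 ≤ r ^ 2 / ρ := by positivity
    have hg := (hasSum_geometric_of_lt_one hq0 hq).mul_left (r ^ 2 / ρ)
    have e4 : r ^ 2 / ρ * (1 - r ^ 2 / ρ)⁻¹ = r ^ 2 / (ρ - r ^ 2) := by
      have : ρ - r ^ 2 ≠ 0 := by linarith
      field_simp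
    rw [← e4]
    refine le_trans (le_of_eq (Finset.sum_congr rfl fun n _ => ?_))
      (sum_le_hasSum (Finset.range N) (fun n _ => by positivity) hg)
    rw [← pow_mul, mul_comm (n + 1), pow_mul, div_pow, hσ, pow_succ']
  rw [e1, e2] at hcs
  have hA := hp.sum_norm_sq_le hφ hρ0.le hρ N
  set S := ∑ n ∈ Finset.range N, ‖p (n + 1)‖ ^ 2 * ρ ^ (n + 1)
  have hS : 0 ≤ S := Finset.sum_nonneg fun n _ => by positivity
  refine le_of_sq_le_sq ?_ hB
  refine hcs.trans ((mul_le_mul_of_nonneg_left e3 hS).trans ?_)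
  have hd1 : 0 < 1 - ‖p 0‖ ^ 2 * ρ := by linarith
  have hd2 : 0 < ρ - r ^ 2 := by linarith
  rw [← mul_div_assoc, div_le_iff₀ hd2]
  refine le_of_mul_le_mul_left ?_ hd1
  calc (1 - ‖p 0‖ ^ 2 * ρ) * (S * r ^ 2) = ((1 - ‖p 0‖ ^ 2 * ρ) * S) * r ^ 2 := by ring
    _ ≤ ρ * (1 - ‖p 0‖ ^ 2) ^ 2 * r ^ 2 := by gcongr
    _ ≤ _ := h
    _ = _ := by ring

theorem radius_lt_one {x : ℝ} (h0 : 0 ≤ x) : radius x < 1 := by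
  unfold radius
  split_ifs with h
  · rw [Real.sqrt_lt' one_pos]; linarith
  · rw [div_lt_one (by linarith)]; linarith

theorem one_third_le_radius {x : ℝ} (h1 : x ≤ 1) : 1 / 3 ≤ radius x := by
  unfold radius
  split_ifs with h
  · exact Real.le_sqrt_of_sq_le (by linarith)
  · exact one_div_le_one_div_of_le (by linarith) (by linarith)

theorem HasTaylor.majorant_le_one (hφ : ClassB φ) (hp : HasTaylor φ p) {r : ℝ} (h0 : 0 ≤ r)
    (hr : r ≤ radius ‖p 0‖) : majorant p r ≤ 1 := by
  have ha : ‖p 0‖ ≤ 1 := hp.apply_zero ▸ hφ.2 0 (by simp [disk])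
  have ha0 := norm_nonneg (p 0)
  have hs := hp.summable h0 (hr.trans_lt (radius_lt_one ha0))
  suffices H : ∀ N, ∑ n ∈ Finset.range N, ‖p (n + 1)‖ * r ^ (n + 1) ≤ 1 - ‖p 0‖ by
    have := Real.tsum_le_of_sum_range_le (fun n => by positivity) H
    rw [majorant, hs.tsum_eq_zero_add]
    simp only [pow_zero, mul_one]
    linarith
  rcases h0.eq_or_lt with rfl | h0
  · intro N
    simpa using ha
  -- The best ρ maximizes (1 - A²ρ)(ρ - r²)/ρ = 1 + A²r² - A²ρ - r²/ρ, that is ρ = r/A. This is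
  -- admissible for A ≥ 1/2, as then r ≤ 1/(1 + 2A) ≤ A; for A < 1/2 the endpoint ρ = 1 is used.
  unfold radius at hr
  split_ifs at hr with h
  · have hr2 : r ^ 2 ≤ (1 - ‖p 0‖) / 2 := by
      rw [Real.le_sqrt h0.le (by linarith)] at hr
      exact hr
    have hlt : ‖p 0‖ ^ 2 < 1 := by nlinarith
    refine hp.sum_norm_le_of_weight hφ (ρ := 1) (by linarith) le_rfl (by linarith)
      (by linarith) ?_
    have h1 : 0 ≤ (1 - ‖p 0‖) ^ 2 * (1 + ‖p 0‖) := by positivity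
    nlinarith [mul_le_mul_of_nonneg_left hr2 h1]
  · have hapos : 0 < ‖p 0‖ := by linarith
    rw [le_div_iff₀ (by linarith)] at hr
    have hra : r ≤ ‖p 0‖ := by nlinarith
    have har : ‖p 0‖ ^ 2 * (r / ‖p 0‖) = ‖p 0‖ * r := by field_simp
    have har1 : (1 + ‖p 0‖) * r ≤ 1 - ‖p 0‖ * r := by linarith
    have hr1 : ‖p 0‖ * r < 1 := by nlinarith
    refine hp.sum_norm_le_of_weight hφ (ρ := r / ‖p 0‖) ?_ ((div_le_one hapos).2 hra)
      (by linarith) (by rwa [har]) ?_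
    · rw [lt_div_iff₀ hapos]
      nlinarith
    · rw [har]
      have e : r / ‖p 0‖ - r ^ 2 = r / ‖p 0‖ * (1 - ‖p 0‖ * r) := by field_simp
      have h2 : ((1 + ‖p 0‖) * r) ^ 2 ≤ (1 - ‖p 0‖ * r) ^ 2 :=
        pow_le_pow_left₀ (by positivity) har1 2
      have h3 : 0 ≤ r / ‖p 0‖ * (1 - ‖p 0‖) ^ 2 := by positivity
      calc _ = r / ‖p 0‖ * (1 - ‖p 0‖) ^ 2 * ((1 + ‖p 0‖) * r) ^ 2 := by ring
        _ ≤ r / ‖p 0‖ * (1 - ‖p 0‖) ^ 2 * (1 - ‖p 0‖ * r) ^ 2 := by gcongr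
        _ = _ := by rw [e]; ring

/-! ### Majorants of products, powers and compositions -/

theorem majorant_mul_le {P Q : PowerSeries ℂ} {r : ℝ} (h0 : 0 ≤ r)
    (hP : Summable fun n => ‖P.coeff n‖ * r ^ n) (hQ : Summable fun n => ‖Q.coeff n‖ * r ^ n) :
    (Summable fun n => ‖(P * Q).coeff n‖ * r ^ n) ∧
      majorant (fun n => (P * Q).coeff n) r ≤
        majorant (fun n => P.coeff n) r * majorant (fun n => Q.coeff n) r := by
  have hle (n : ℕ) : ‖(P * Q).coeff n‖ * r ^ n ≤ ∑ x ∈ Finset.HasAntidiagonal.antidiagonal n,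
      (‖P.coeff x.1‖ * r ^ x.1) * (‖Q.coeff x.2‖ * r ^ x.2) := by
    rw [PowerSeries.coeff_mul]
    refine (mul_le_mul_of_nonneg_right (norm_sum_le _ _) (by positivity)).trans_eq ?_
    rw [Finset.sum_mul]
    refine Finset.sum_congr rfl fun x hx => ?_
    rw [← Finset.HasAntidiagonal.mem_antidiagonal.1 hx, pow_add, norm_mul]
    ring
  have hP' : Summable fun n => ‖‖P.coeff n‖ * r ^ n‖ := hP.norm
  have hQ' : Summable fun n => ‖‖Q.coeff n‖ * r ^ n‖ := hQ.norm
  have hs := (summable_norm_sum_mul_antidiagonal_of_summable_norm hP' hQ').of_norm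
  have hs' := hs.of_nonneg_of_le (fun n => by positivity) hle
  refine ⟨hs', ?_⟩
  unfold majorant
  rw [tsum_mul_tsum_eq_tsum_sum_antidiagonal_of_summable_norm hP' hQ']
  exact hs'.tsum_le_tsum hle hs

theorem norm_summable_of_norm_le {c : ℕ → ℂ} {r : ℝ} (hc : Summable fun n => ‖c n‖ * r ^ n)
    {z : ℂ} (hz : ‖z‖ ≤ r) : Summable fun n => ‖c n * z ^ n‖ := by
  refine hc.of_nonneg_of_le (fun n => norm_nonneg _) fun n => ?_
  rw [norm_mul, norm_pow]
  gcongr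

theorem hasSum_coeff_mul {P Q : PowerSeries ℂ} {r : ℝ}
    (hP : Summable fun n => ‖P.coeff n‖ * r ^ n) (hQ : Summable fun n => ‖Q.coeff n‖ * r ^ n)
    {z s t : ℂ} (hz : ‖z‖ ≤ r) (hs : HasSum (fun n => P.coeff n * z ^ n) s)
    (ht : HasSum (fun n => Q.coeff n * z ^ n) t) :
    HasSum (fun n => (P * Q).coeff n * z ^ n) (s * t) := by
  have hP' := norm_summable_of_norm_le hP hz
  have hQ' := norm_summable_of_norm_le hQ hz
  have h1 := (summable_norm_sum_mul_antidiagonal_of_summable_norm hP' hQ').of_norm.hasSum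
  rw [← tsum_mul_tsum_eq_tsum_sum_antidiagonal_of_summable_norm hP' hQ', hs.tsum_eq,
    ht.tsum_eq] at h1
  convert! h1 using 2 with n
  rw [PowerSeries.coeff_mul, Finset.sum_mul]
  refine Finset.sum_congr rfl fun x hx => ?_
  rw [← Finset.HasAntidiagonal.mem_antidiagonal.1 hx, pow_add]
  ring

theorem majorant_pow_le {P : PowerSeries ℂ} {r : ℝ} (h0 : 0 ≤ r)
    (hP : Summable fun n => ‖P.coeff n‖ * r ^ n) (k : ℕ) :
    (Summable fun n => ‖(P ^ k).coeff n‖ * r ^ n) ∧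
      majorant (fun n => (P ^ k).coeff n) r ≤ majorant (fun n => P.coeff n) r ^ k := by
  induction k with
  | zero =>
    have : HasSum (fun n => ‖(1 : PowerSeries ℂ).coeff n‖ * r ^ n) 1 := by
      convert! hasSum_single (f := fun n => ‖(1 : PowerSeries ℂ).coeff n‖ * r ^ n) 0
        (fun n hn => by simp [PowerSeries.coeff_one, hn]) using 1
      simp
    simpa only [pow_zero, majorant] using ⟨this.summable, this.tsum_eq.le⟩
  | succ k ih =>
    have := majorant_mul_le h0 ih.1 hP
    rw [pow_succ, pow_succ]
    refine ⟨this.1, this.2.trans (mul_le_mul_of_nonneg_right ih.2 ?_)⟩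
    exact tsum_nonneg fun n => by positivity

theorem hasSum_coeff_pow {P : PowerSeries ℂ} {r : ℝ}
    (hP : Summable fun n => ‖P.coeff n‖ * r ^ n) {z s : ℂ} (hz : ‖z‖ ≤ r)
    (hs : HasSum (fun n => P.coeff n * z ^ n) s) (k : ℕ) :
    HasSum (fun n => (P ^ k).coeff n * z ^ n) (s ^ k) := by
  induction k with
  | zero =>
    convert! hasSum_single (f := fun n => (1 : PowerSeries ℂ).coeff n * z ^ n) 0
      (fun n hn => by simp [PowerSeries.coeff_one, hn]) using 1
    simp
  | succ k ih =>
    rw [pow_succ, pow_succ]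
    exact hasSum_coeff_mul (majorant_pow_le ((norm_nonneg z).trans hz) hP k).1 hP hz ih hs

/-- The double series b_k [z^n]ω^k z^n converges absolutely, dominated by ∑ |b_k| r^k, so it may be
summed by powers of z; uniqueness identifies the result with the coefficients of f. -/
theorem majorant_comp_le {P : PowerSeries ℂ} {r : ℝ} (h0 : 0 < r) (hr : r < 1)
    (hf : HasTaylor f a) (hg : HasTaylor g b)
    (hP : Summable fun n => ‖P.coeff n‖ * r ^ n) (hPr : majorant (fun n => P.coeff n) r ≤ r)
    (hω : ∀ z : ℂ, ‖z‖ < r → HasSum (fun n => P.coeff n * z ^ n) (ω z))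
    (hfg : ∀ z : ℂ, ‖z‖ < r → f z = g (ω z)) : majorant a r ≤ majorant b r := by
  have hmaj0 : 0 ≤ majorant (fun n => P.coeff n) r := tsum_nonneg fun n => by positivity
  have hb := hg.summable h0.le hr
  have hpow (k : ℕ) := majorant_pow_le h0.le hP k
  have hsk (k : ℕ) : HasSum (fun n => ‖b k‖ * (‖(P ^ k).coeff n‖ * r ^ n))
      (‖b k‖ * majorant (fun n => (P ^ k).coeff n) r) := (hpow k).1.hasSum.mul_left _
  have hkle (k : ℕ) : ‖b k‖ * majorant (fun n => (P ^ k).coeff n) r ≤ ‖b k‖ * r ^ k :=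
    mul_le_mul_of_nonneg_left ((hpow k).2.trans (pow_le_pow_left₀ hmaj0 hPr k)) (norm_nonneg _)
  have hks : Summable fun k => ‖b k‖ * majorant (fun n => (P ^ k).coeff n) r :=
    hb.of_nonneg_of_le (fun k => mul_nonneg (norm_nonneg _) (tsum_nonneg fun n => by positivity))
      hkle
  have hG : Summable (Function.uncurry fun k n : ℕ => ‖b k‖ * (‖(P ^ k).coeff n‖ * r ^ n)) := by
    refine (summable_prod_of_nonneg fun x => ?_).2 ⟨fun k => (hsk k).summable, ?_⟩
    · simp only [Function.uncurry, Pi.zero_apply]; positivity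
    · simpa only [Function.uncurry, (hsk _).tsum_eq] using hks
  have hGn (n : ℕ) : Summable fun k => ‖b k‖ * (‖(P ^ k).coeff n‖ * r ^ n) :=
    hG.prod_symm.prod_factor n
  let A : ℕ → ℂ := fun n => ∑' k, b k * (P ^ k).coeff n
  have hFn (n : ℕ) : Summable fun k => ‖b k * (P ^ k).coeff n‖ := by
    have := (hGn n).mul_right (r ^ n)⁻¹
    refine this.congr fun k => ?_
    rw [norm_mul]
    field_simp
  have hAle (n : ℕ) : ‖A n‖ * r ^ n ≤ ∑' k, ‖b k‖ * (‖(P ^ k).coeff n‖ * r ^ n) := by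
    refine (mul_le_mul_of_nonneg_right (norm_tsum_le_tsum_norm (hFn n)) (by positivity)).trans_eq ?_
    rw [← tsum_mul_right]
    simp only [norm_mul, mul_assoc]
  have hGt : Summable fun n => ∑' k, ‖b k‖ * (‖(P ^ k).coeff n‖ * r ^ n) := hG.prod_symm.prod
  have hAs : Summable fun n => ‖A n‖ * r ^ n :=
    hGt.of_nonneg_of_le (fun n => by positivity) hAle
  have hAsum (z : ℂ) (hz : ‖z‖ < r) : HasSum (fun n => A n * z ^ n) (f z) := by
    have hzpow (k : ℕ) := hasSum_coeff_pow hP hz.le (hω z hz) k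
    have hF : Summable (Function.uncurry fun k n : ℕ => b k * ((P ^ k).coeff n * z ^ n)) := by
      refine Summable.of_norm (hG.of_nonneg_of_le (fun x => norm_nonneg _) fun x => ?_)
      simp only [Function.uncurry, norm_mul, norm_pow]
      gcongr
    have hωz : ω z ∈ disk := by
      refine mem_disk.2 (lt_of_le_of_lt ?_ hr)
      rw [← (hω z hz).tsum_eq]
      have hn := norm_summable_of_norm_le hP hz.le
      refine (norm_tsum_le_tsum_norm hn).trans ((hn.tsum_le_tsum (fun n => ?_) hP).trans hPr)
      rw [norm_mul, norm_pow]
      gcongr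
    have h1 : ∑' k, ∑' n, b k * ((P ^ k).coeff n * z ^ n) = f z := by
      simp only [tsum_mul_left, (hzpow _).tsum_eq]
      rw [hfg z hz]
      exact (hg.2 _ hωz).tsum_eq
    have h2 : Summable fun n => ∑' k, b k * ((P ^ k).coeff n * z ^ n) := hF.prod_symm.prod
    have h3 := h2.hasSum
    rw [hF.tsum_comm, h1] at h3
    simpa only [A, ← tsum_mul_right, mul_assoc] using h3
  have haA : a = A := coeff_unique h0 (hf.summable h0.le hr) hAs
    (fun z hz => hf.2 z (mem_disk.2 (hz.trans hr))) hAsum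
  calc majorant a r = ∑' n, ‖A n‖ * r ^ n := by rw [haA]; rfl
    _ ≤ ∑' n, ∑' k, ‖b k‖ * (‖(P ^ k).coeff n‖ * r ^ n) := hAs.tsum_le_tsum hAle hGt
    _ = ∑' k, ‖b k‖ * majorant (fun n => (P ^ k).coeff n) r := by
      rw [hG.tsum_comm]
      exact tsum_congr fun k => (hsk k).tsum_eq
    _ ≤ majorant b r := hks.tsum_le_tsum hkle hb

theorem ClassB.dslope (hω : ClassB ω) (h0 : ω 0 = 0) : ClassB (dslope ω 0) := by
  refine ⟨(Complex.differentiableOn_dslope (isOpen_ball.mem_nhds (by simp))).2 hω.1,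
    fun z hz => ?_⟩
  have := Complex.norm_dslope_le_div_of_mapsTo_ball (R₂ := 1) hω.1
    (fun w hw => by simpa [h0] using hω.2 w hw) hz
  simpa using this

theorem majorant_le_of_le_radius (hf : HasTaylor f a) (hg : HasTaylor g b) (hω : ClassB ω)
    (hω0 : ω 0 = 0) (hfg : ∀ z ∈ disk, f z = g (ω z)) {r : ℝ} (h0 : 0 ≤ r)
    (hr : r ≤ radius ‖deriv ω 0‖) : majorant a r ≤ majorant b r := by
  have hr1 := hr.trans_lt (radius_lt_one (norm_nonneg _))
  rcases h0.eq_or_lt with rfl | h0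
  · have hz (c : ℕ → ℂ) : majorant c 0 = ‖c 0‖ := by
      rw [majorant, tsum_eq_single 0 (fun n hn => by simp [hn])]
      simp
    rw [hz, hz, ← hf.apply_zero, ← hg.apply_zero, hfg 0 (by simp [disk]), hω0]
  have hφ := hω.dslope hω0
  obtain ⟨p, hp⟩ := exists_hasTaylor hφ.1
  have hp0 : p 0 = deriv ω 0 := by rw [← hp.apply_zero, dslope_same]
  have hps := hp.summable h0.le hr1
  have hX : HasSum (fun n => ‖(PowerSeries.X : PowerSeries ℂ).coeff n‖ * r ^ n) r := by
    convert! hasSum_single (f := fun n => ‖(PowerSeries.X : PowerSeries ℂ).coeff n‖ * r ^ n) 1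
      (fun n hn => by simp [PowerSeries.coeff_X, hn]) using 1
    simp
  have hP := majorant_mul_le (P := PowerSeries.X) (Q := PowerSeries.mk p) h0.le hX.summable
    (by simpa using hps)
  refine majorant_comp_le h0 hr1 hf hg hP.1 (hP.2.trans ?_) (fun z hz => ?_) fun z hz =>
    hfg z (mem_disk.2 (hz.trans hr1))
  · have h1 : majorant (fun n => (PowerSeries.X : PowerSeries ℂ).coeff n) r = r := hX.tsum_eq
    simp only [h1, PowerSeries.coeff_mk]
    exact mul_le_of_le_one_right h0.le (hp.majorant_le_one hφ h0.le (by rwa [hp0]))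
  · have hXz : HasSum (fun n => (PowerSeries.X : PowerSeries ℂ).coeff n * z ^ n) z := by
      convert! hasSum_single (f := fun n => (PowerSeries.X : PowerSeries ℂ).coeff n * z ^ n) 1
        (fun n hn => by simp [PowerSeries.coeff_X, hn]) using 1
      simp
    have := hasSum_coeff_mul (Q := PowerSeries.mk p) hX.summable (by simpa using hps) hz.le hXz
      (by simpa using hp.2 z (mem_disk.2 (hz.trans hr1)))
    have hz' : z * _root_.dslope ω 0 z = ω z := by
      simpa [hω0] using sub_smul_dslope ω 0 z
    rwa [hz'] at this

theorem coeff_one_eq (hf : HasTaylor f a) (hg : HasTaylor g b) (hω : ClassB ω)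
    (hω0 : ω 0 = 0) (hfg : ∀ z ∈ disk, f z = g (ω z)) : a 1 = b 1 * deriv ω 0 := by
  have hn : disk ∈ 𝓝 (0 : ℂ) := isOpen_ball.mem_nhds (by simp)
  have h1 : HasDerivAt (g ∘ ω) (b 1 * deriv ω 0) 0 :=
    HasDerivAt.comp 0 (by rw [hω0]; exact hg.hasDerivAt) (hω.1.differentiableAt hn).hasDerivAt
  exact hf.hasDerivAt.unique (h1.congr_of_eventuallyEq (mem_of_superset hn hfg))

/-! ### Extremal functions -/

/-- The triangle inequality on the tail at the point r bounds a majorant from below without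
computing coefficients. -/
theorem norm_add_norm_sub_le_majorant {c : ℕ → ℂ} {r : ℝ} (h0 : 0 ≤ r)
    (hc : Summable fun n => ‖c n‖ * r ^ n) {s : ℂ}
    (hs : HasSum (fun n => c n * (r : ℂ) ^ n) s) : ‖c 0‖ + ‖s - c 0‖ ≤ majorant c r := by
  have h1 := (hasSum_nat_add_iff' 1).2 hs
  simp only [Finset.sum_range_one, pow_zero, mul_one] at h1
  rw [majorant, hc.tsum_eq_zero_add, ← h1.tsum_eq, pow_zero, mul_one]
  have e (n : ℕ) : ‖c (n + 1) * (r : ℂ) ^ (n + 1)‖ = ‖c (n + 1)‖ * r ^ (n + 1) := by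
    rw [norm_mul, norm_pow, Complex.norm_real, Real.norm_of_nonneg h0]
  have h2 : Summable fun n => ‖c (n + 1) * (r : ℂ) ^ (n + 1)‖ := by
    simpa only [e] using (summable_nat_add_iff 1).2 hc
  have := norm_tsum_le_tsum_norm h2
  simp only [e] at this
  gcongr

/-- The coefficients of `z ^ m * ψ z`. -/
def shiftCoeff (m : ℕ) (p : ℕ → ℂ) (n : ℕ) : ℂ := if n < m then 0 else p (n - m)

theorem shiftCoeff_add (m : ℕ) (p : ℕ → ℂ) (n : ℕ) : shiftCoeff m p (n + m) = p n := by
  simp [shiftCoeff]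

theorem HasTaylor.shift (hψ : HasTaylor ψ p) (m : ℕ) :
    HasTaylor (fun z => z ^ m * ψ z) (shiftCoeff m p) := by
  refine ⟨(differentiableOn_id.pow m).mul hψ.1, fun z hz => (hasSum_nat_add_iff' m).1 ?_⟩
  have h0 : ∑ i ∈ Finset.range m, shiftCoeff m p i * z ^ i = 0 :=
    Finset.sum_eq_zero fun i hi => by simp [shiftCoeff, Finset.mem_range.1 hi]
  rw [h0, sub_zero]
  convert! (hψ.2 z hz).mul_left (z ^ m) using 2 with n
  rw [shiftCoeff_add, pow_add]
  ring

theorem HasTaylor.majorant_shift (hψ : HasTaylor ψ p) (m : ℕ) {r : ℝ} (h0 : 0 ≤ r) (h1 : r < 1) :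
    majorant (shiftCoeff m p) r = r ^ m * majorant p r := by
  rw [majorant, ← ((hψ.shift m).summable h0 h1).sum_add_tsum_nat_add m,
    Finset.sum_eq_zero fun i hi => by simp [shiftCoeff, Finset.mem_range.1 hi], zero_add,
    majorant, ← tsum_mul_left]
  refine tsum_congr fun n => ?_
  rw [shiftCoeff_add, pow_add]
  ring

theorem hasTaylor_one : HasTaylor (fun _ => 1) (Pi.single 0 1) :=
  ⟨differentiableOn_const _, fun z _ => by
    convert! hasSum_single (f := fun n => (Pi.single 0 1 : ℕ → ℂ) n * z ^ n) 0
      (fun n hn => by simp [hn]) using 1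
    simp⟩

theorem majorant_single_zero_one (r : ℝ) : majorant (Pi.single 0 1) r = 1 := by
  rw [majorant, tsum_eq_single 0 (fun n hn => by simp [hn])]
  simp

/-- The disk automorphism `z ↦ (x - z) / (1 - x z)`. -/
noncomputable def moebius (x : ℝ) (z : ℂ) : ℂ := (x - z) / (1 - x * z)

theorem moebius_zero (x : ℝ) : moebius x 0 = x := by simp [moebius]

theorem moebius_ofReal (x r : ℝ) : moebius x r = ((x - r) / (1 - x * r) : ℝ) := by
  simp [moebius]

theorem classB_moebius {x : ℝ} (h0 : 0 ≤ x) (h1 : x < 1) : ClassB (moebius x) := by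
  have hx : ‖(x : ℂ)‖ < 1 := by rwa [Complex.norm_real, Real.norm_of_nonneg h0]
  have hne (z : ℂ) (hz : z ∈ disk) : 1 - (x : ℂ) * z ≠ 0 := by
    simpa using one_sub_conj_mul_ne_zero hx (mem_disk.1 hz).le
  refine ⟨(differentiableOn_id.const_sub _).div
    ((differentiableOn_id.const_mul _).const_sub _) hne, fun z hz => ?_⟩
  rw [moebius, norm_div]
  refine div_le_one_of_le₀ ?_ (norm_nonneg _)
  rw [norm_sub_rev]
  simpa using norm_sub_le_norm_one_sub_conj_mul hx.le (mem_disk.1 hz).le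

theorem ClassB.pow_mul {ψ : ℂ → ℂ} (hψ : ClassB ψ) (m : ℕ) : ClassB fun z => z ^ m * ψ z :=
  ⟨(differentiableOn_id.pow m).mul hψ.1, fun z hz => by
    rw [norm_mul, norm_pow]
    exact mul_le_one₀ (pow_le_one₀ (norm_nonneg _) (mem_disk.1 hz).le) (norm_nonneg _)
      (hψ.2 z hz)⟩

/-- The majorant of `(z ^ m * moebius x z) ^ k` exceeds that of `z ^ k` as soon as
`r ^ k < r ^ (m * k) * (2 * x ^ k - moebius x r ^ k)`. -/
theorem exists_subordinate_majorant_lt {x r : ℝ} {j m k : ℕ} (hx0 : 0 ≤ x) (hx1 : x < 1)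
    (h0 : 0 ≤ r) (h1 : r < 1) (hm : m ≠ 0)
    (h : r ^ k < r ^ (m * k) * (2 * x ^ k - ((x - r) / (1 - x * r)) ^ k)) (hj : j = m * k) :
    ∃ (f g : ℂ → ℂ) (p : ℕ → ℂ),
      HasTaylor f (shiftCoeff j p) ∧ HasTaylor g (shiftCoeff k (Pi.single 0 1)) ∧
      Subordinate f g ∧ p 0 = x ^ k ∧
      majorant (shiftCoeff k (Pi.single 0 1)) r < majorant (shiftCoeff j p) r := by
  subst hj
  have hB := classB_moebius hx0 hx1
  obtain ⟨p, hp⟩ := exists_hasTaylor (hB.1.pow k)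
  have hp0 : p 0 = x ^ k := by rw [← hp.apply_zero]; simp [moebius_zero]
  refine ⟨_, _, p, hp.shift (m * k), hasTaylor_one.shift k,
    ⟨fun z => z ^ m * moebius x z, hB.pow_mul m, by simp [hm], fun z _ => ?_⟩, hp0, ?_⟩
  · simp only [Pi.pow_apply, mul_one]
    rw [mul_pow, pow_mul]
  · rw [hasTaylor_one.majorant_shift k h0 h1, majorant_single_zero_one, mul_one,
      hp.majorant_shift _ h0 h1]
    refine h.trans_le (mul_le_mul_of_nonneg_left ?_ (by positivity))
    have := norm_add_norm_sub_le_majorant h0 (hp.summable h0 h1) (hp.2 r (ofReal_mem_disk h0 h1))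
    refine le_trans ?_ this
    rw [hp0, Pi.pow_apply, moebius_ofReal]
    norm_cast
    rw [Real.norm_of_nonneg (by positivity : 0 ≤ x ^ k)]
    have := neg_le_abs (((x - r) / (1 - x * r)) ^ k - x ^ k)
    rw [Real.norm_eq_abs]
    linarith

theorem exists_between_lt_one {c R : ℝ} (h : c < R) (h1 : c < 1) : ∃ r, c < r ∧ r < R ∧ r < 1 := by
  obtain ⟨r, hr, hr'⟩ := exists_between (lt_min h h1)
  exact ⟨r, hr, hr'.trans_le (min_le_left _ _), hr'.trans_le (min_le_right _ _)⟩

end BohrSubordination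

open BohrSubordination in
theorem corollary2 :
    -- the inequality, with convergence of both series
    (∀ (f g : ℂ → ℂ) (a b : ℕ → ℂ),
      BohrSubordination.HasTaylor f a → BohrSubordination.HasTaylor g b →
      BohrSubordination.Subordinate f g →
      (b 1 ≠ 0 → ∀ r : ℝ, 0 ≤ r → r ≤ BohrSubordination.radius ‖a 1 / b 1‖ →
        Summable (fun k : ℕ => ‖a k‖ * r ^ k) ∧ Summable (fun k : ℕ => ‖b k‖ * r ^ k) ∧
        BohrSubordination.majorant a r ≤ BohrSubordination.majorant b r) ∧
      (b 1 = 0 → ∀ r : ℝ, 0 ≤ r → r ≤ 1 / 3 →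
        Summable (fun k : ℕ => ‖a k‖ * r ^ k) ∧ Summable (fun k : ℕ => ‖b k‖ * r ^ k) ∧
        BohrSubordination.majorant a r ≤ BohrSubordination.majorant b r)) ∧
    -- sharpness of the radius in the case `b 1 ≠ 0`
    (∀ x ∈ Set.Ico (1 / 2 : ℝ) 1 ∪ {0}, ∀ R : ℝ, BohrSubordination.radius x < R →
      ∃ (f g : ℂ → ℂ) (a b : ℕ → ℂ),
        BohrSubordination.HasTaylor f a ∧ BohrSubordination.HasTaylor g b ∧
        BohrSubordination.Subordinate f g ∧ b 1 ≠ 0 ∧ ‖a 1 / b 1‖ = x ∧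
        ∃ r : ℝ, BohrSubordination.radius x < r ∧ r < R ∧ r < 1 ∧
          BohrSubordination.majorant b r < BohrSubordination.majorant a r) ∧
    -- sharpness of `1 / 3` in the case `b 1 = 0`
    (∀ R : ℝ, 1 / 3 < R →
      ∃ (f g : ℂ → ℂ) (a b : ℕ → ℂ),
        BohrSubordination.HasTaylor f a ∧ BohrSubordination.HasTaylor g b ∧
        BohrSubordination.Subordinate f g ∧ b 1 = 0 ∧
        ∃ r : ℝ, 1 / 3 < r ∧ r < R ∧ r < 1 ∧
          BohrSubordination.majorant b r < BohrSubordination.majorant a r) := by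
  refine ⟨fun f g a b hf hg ⟨ω, hω, hω0, hfg⟩ => ⟨fun hb r h0 hr => ?_, fun _ r h0 hr => ?_⟩,
    ?_, fun R hR => ?_⟩
  · have hr1 := hr.trans_lt (radius_lt_one (norm_nonneg _))
    refine ⟨hf.summable h0 hr1, hg.summable h0 hr1,
      majorant_le_of_le_radius hf hg hω hω0 hfg h0 ?_⟩
    rwa [coeff_one_eq hf hg hω hω0 hfg, mul_div_cancel_left₀ _ hb] at hr
  · have hr1 : r < 1 := by linarith
    refine ⟨hf.summable h0 hr1, hg.summable h0 hr1,
      majorant_le_of_le_radius hf hg hω hω0 hfg h0 (hr.trans (one_third_le_radius ?_))⟩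
    rw [← dslope_same]
    exact (hω.dslope hω0).2 0 (by simp [disk])
  · rintro x (⟨hx, hx1⟩ | rfl) R hR
    · obtain ⟨r, hr, hrR, hr1⟩ := exists_between_lt_one hR (radius_lt_one (by linarith))
      have hr' : 1 / (1 + 2 * x) < r := by rwa [radius, if_neg (not_lt.2 hx)] at hr
      have h0 : 0 < r := lt_trans (by positivity) hr'
      rw [div_lt_iff₀ (by linarith)] at hr'
      have hd : 0 < 1 - x * r := by nlinarith
      obtain ⟨f, g, p, hf, hg, hfg, hp, hlt⟩ := exists_subordinate_majorant_lt
        (x := x) (r := r) (j := 1) (m := 1) (k := 1) (by linarith) hx1 h0.le hr1 one_ne_zero (by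
          -- Cleared of its denominator, this is (1 - x) < r (1 - x)(1 + 2x).
          have : (x - r) / (1 - x * r) < 2 * x - 1 := by
            rw [div_lt_iff₀ hd]
            nlinarith
          simp only [pow_one, mul_one]
          nlinarith) rfl
      refine ⟨f, g, _, _, hf, hg, hfg, by simp [shiftCoeff], ?_, r, hr, hrR, hr1, hlt⟩
      simp [shiftCoeff, hp, abs_of_nonneg (show 0 ≤ x by linarith)]
    · obtain ⟨r, hr, hrR, hr1⟩ := exists_between_lt_one hR (radius_lt_one le_rfl)
      have hr' : √(1 / 2) < r := by simpa [radius] using hr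
      set c := √(1 / 2 : ℝ)
      have hc : c ^ 2 = 1 / 2 := Real.sq_sqrt (by norm_num)
      have hc0 : 0 < c := Real.sqrt_pos.2 (by norm_num)
      have hc1 : c < 1 := by nlinarith
      have h0 : 0 < r := hc0.trans hr'
      have hd : 0 < 1 - c * r := by nlinarith
      obtain ⟨f, g, p, hf, hg, hfg, hp, hlt⟩ := exists_subordinate_majorant_lt
        (x := c) (r := r) (j := 2) (m := 2) (k := 1) hc0.le hc1 h0.le hr1 two_ne_zero (by
          -- Here c = 1/√2 is the critical radius itself, so the Möbius factor vanishes at r = c,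
          -- where also 2cr = 1; past c both inequalities become strict.
          have h1 : (c - r) / (1 - c * r) < 0 := div_neg_of_neg_of_pos (by linarith) hd
          have h2 : 1 < r * (2 * c) := by nlinarith
          simp only [pow_one, mul_one]
          nlinarith [mul_pos h0 h0]) rfl
      refine ⟨f, g, _, _, hf, hg, hfg, by simp [shiftCoeff], ?_, r, hr, hrR, hr1, hlt⟩
      simp [shiftCoeff]
  · obtain ⟨r, hr, hrR, hr1⟩ := exists_between_lt_one hR (by norm_num)
    have h0 : 0 < r := by linarith
    -- Since (1 - xr)² - (x - r)² = (1 - x²)(1 - r²), the required excess reduces, after division by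
    -- 1 - x², to 2(1 - xr)² < 1 - r². At x = 1 this says exactly r > 1/3, so it persists for x
    -- slightly below 1.
    have hev : ∀ᶠ x : ℝ in 𝓝[<] 1, 2 * (1 - x * r) ^ 2 < 1 - r ^ 2 ∧ 0 < x ∧ x < 1 := by
      have hc : ContinuousAt (fun x : ℝ => 2 * (1 - x * r) ^ 2) 1 := by fun_prop
      have h1 : ∀ᶠ x : ℝ in 𝓝 1, 2 * (1 - x * r) ^ 2 < 1 - r ^ 2 :=
        hc.eventually_lt_const (by nlinarith)
      exact (h1.filter_mono nhdsWithin_le_nhds).and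
        (((lt_mem_nhds one_pos).filter_mono nhdsWithin_le_nhds).and self_mem_nhdsWithin)
    obtain ⟨x, hx, hx0, hx1⟩ := hev.exists
    have hd : 0 < 1 - x * r := by nlinarith
    obtain ⟨f, g, p, hf, hg, hfg, hp, hlt⟩ := exists_subordinate_majorant_lt
      (x := x) (r := r) (j := 2) (m := 1) (k := 2) hx0.le hx1 h0.le hr1 one_ne_zero (by
        have : ((x - r) / (1 - x * r)) ^ 2 < 2 * x ^ 2 - 1 := by
          rw [div_pow, div_lt_iff₀ (by positivity)]
          nlinarith [mul_lt_mul_of_pos_left hx (show 0 < 1 - x ^ 2 by nlinarith)]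
        rw [one_mul]
        nlinarith [mul_pos h0 h0]) rfl
    exact ⟨f, g, _, _, hf, hg, hfg, by simp [shiftCoeff], r, hr, hrR, hr1, hlt⟩
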